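/- Let $a,b,c,d,e\in\mathbb{R}$ with $b\neq 0$, let $Q(x,y)=ax^2+bxy+cy^2+dx+ey$, and let $z\in\{i,-i\}$. For $f\in L^1(\mathbb{R})$ (complex-valued) put $$(\mathbb{H}_Q f)(x)=\sqrt{\frac{|b|}{2\pi}}\int_{\mathbb{R}}\frac{e^{-iQ(x,y)}+z\,e^{-iQ(-x,y)}}{2}\,f(y)\,dy,\qquad x\in\mathbb{R}.$$ Let $p\in[1,2]$ and let $p_1\in[2,\infty]$ be its conjugate exponent, $\frac1p+\frac1{p_1}=1$. Then there is exactly one continuous linear operator $L^p(\mathbb{R})\to L^{p_1}(\mathbb{R})$ that agrees almost everywhere with the integral above for every $f\in L^1(\mathbb{R})\cap L^p(\mathbb{R})$; and this operator, again denoted by $\mathbb{H}_Q$, satisfies $$\|\mathbb{H}_Q f\|_{L^{p_1}(\mathbb{R})}\le\left(\sqrt{\frac{|b|}{2\pi}}\right)^{\frac2p-1}\|f\|_{L^p(\mathbb{R})}\qquad\text{for all } f\in L^p(\mathbb{R}).$$ -/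

import Mathlib

open MeasureTheory

noncomputable section

/-- The quadratic phase `Q(x, y) = a x² + b x y + c y² + d x + e y`. -/
def quadPhase (a b c d e x y : ℝ) : ℝ :=
  a * x ^ 2 + b * x * y + c * y ^ 2 + d * x + e * y

/-- The kernel `√(|b| / 2π) · (exp (-i Q(x, y)) + z exp (-i Q(-x, y))) / 2`. -/
def quadHartleyKernel (a b c d e : ℝ) (z : ℂ) (x y : ℝ) : ℂ :=
  (Real.sqrt (|b| / (2 * Real.pi)) : ℂ) *
    ((Complex.exp (-(Complex.I * (quadPhase a b c d e x y : ℂ))) +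
      z * Complex.exp (-(Complex.I * (quadPhase a b c d e (-x) y : ℂ)))) / 2)

/-- The quadratic Hartley integral, meaningful at every `x` when `f` is integrable. -/
def quadHartleyIntegral (a b c d e : ℝ) (z : ℂ) (f : ℝ → ℂ) (x : ℝ) : ℂ :=
  ∫ y : ℝ, quadHartleyKernel a b c d e z x y * f y

/-- `T` is the quadratic Hartley operator from `L^p(ℝ)` to `L^q(ℝ)`: it is continuous and linear,
and it is given almost everywhere by the integral for all `f ∈ L^1 ∩ L^p`
(a dense subspace of `L^p` for `p < ∞`). -/
def IsQuadHartleyOperator (a b c d e : ℝ) (z : ℂ) (p q : ENNReal)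
    [Fact (1 ≤ p)] [Fact (1 ≤ q)]
    (T : Lp ℂ p (volume : Measure ℝ) →L[ℂ] Lp ℂ q (volume : Measure ℝ)) : Prop :=
  ∀ f : Lp ℂ p (volume : Measure ℝ), Integrable (f : ℝ → ℂ) volume →
    (T f : ℝ → ℂ) =ᵐ[volume] quadHartleyIntegral a b c d e z (f : ℝ → ℂ)

end

/-!
The kernel is bounded by `√(|b| / 2π)`, so the integral maps `L¹` into `L^∞` with that norm. On `L²`
it is a contraction: splitting the phase, the integral of `e^{-iQ(x, y)} f(y)` is, up to unimodular
factors, the Fourier transform of a unimodular multiple of `f`, taken at `b x / 2π`; Plancherel's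
theorem and the factor `√(|b| / 2π)` make this a unitary operator, and the quadratic Hartley integral
is half the sum of it and of a unimodular multiple of its reflection
(`eLpNorm_two_quadHartleyIntegral_le`).

The bound for `1 < p < 2` is the Riesz–Thorin interpolation between these two estimates, proved here
for integral operators with bounded kernel (`eLpNorm_kernel_integral_le`). For simple `f` and `g` the
form `∫∫ K(x, y) f(y) g(x)` is embedded into an entire function, bounded on the strip
`0 ≤ re ζ ≤ 1`, to which Hadamard's three lines theorem applies (`norm_kernelForm_le_interpolation`);
duality turns the bound for the form into one for the operator on simple functions, and Fatou's lemma
extends that bound to `L¹ ∩ Lᵖ`.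

As `p` is finite, `L¹ ∩ Lᵖ` contains the simple functions of `Lᵖ` and is dense in `Lᵖ`. The integral
is a bounded linear map on it, so it has exactly one continuous extension to `Lᵖ`, with the same
bound.
-/

section Auxiliary

open Complex FourierTransform SchwartzMap

/-! ### Interpolation of the bilinear form -/

/-- The value `c = 0` is left out of the sum: its level set may have infinite measure, in which case
the set integral of `k` over it would be a junk value. -/
theorem MeasureTheory.SimpleFunc.integral_mul_comp_eq_sum {α : Type*} [MeasurableSpace α]
    {μ : Measure α} (f : SimpleFunc α ℂ) (hf : Integrable f μ) {k : α → ℂ} {C : ℝ}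
    (hk : AEStronglyMeasurable k μ) (hC : ∀ x, ‖k x‖ ≤ C) {φ : ℂ → ℂ} (h0 : φ 0 = 0) :
    ∫ x, k x * φ (f x) ∂μ = ∑ c ∈ f.range with c ≠ 0, φ c * ∫ x in f ⁻¹' {c}, k x ∂μ := by
  have h1 : ∀ x, k x * φ (f x) =
      ∑ c ∈ f.range with c ≠ 0, (f ⁻¹' {c}).indicator (fun x ↦ φ c * k x) x := by
    intro x
    by_cases hx : f x = 0
    · rw [hx, h0, mul_zero, Finset.sum_eq_zero]
      intro c hc
      rw [Set.indicator_of_notMem]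
      simp only [Finset.mem_filter] at hc
      simp only [Set.mem_preimage, Set.mem_singleton_iff, hx]
      exact fun h ↦ hc.2 h.symm
    · rw [Finset.sum_eq_single (f x)]
      · rw [Set.indicator_of_mem (by simp), mul_comm]
      · intro c _ hc
        rw [Set.indicator_of_notMem]
        simpa using hc.symm
      · intro h
        simp [hx] at h
  simp_rw [h1]
  rw [integral_finsetSum]
  · refine Finset.sum_congr rfl fun c _ ↦ ?_
    rw [integral_indicator (f.measurableSet_preimage _), integral_const_mul]
  · intro c hc
    simp only [Finset.mem_filter] at hc
    rw [integrable_indicator_iff (f.measurableSet_preimage _)]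
    exact (Measure.integrableOn_of_bounded
      (SimpleFunc.measure_preimage_lt_top_of_integrable f hf hc.2).ne hk
      (Filter.Eventually.of_forall hC)).const_mul _

/-- The bilinear form `(f, g) ↦ ∫ (∫ K(x, y) f(y) dy) g(x) dx`. -/
noncomputable def kernelForm {α β : Type*} [MeasurableSpace α] [MeasurableSpace β]
    (μ : Measure α) (ν : Measure β) (K : α → β → ℂ) (f : β → ℂ) (g : α → ℂ) : ℂ :=
  ∫ x, (∫ y, K x y * f y ∂ν) * g x ∂μ

theorem norm_kernel_integral_le {α β : Type*} [MeasurableSpace β] {ν : Measure β}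
    {K : α → β → ℂ} {M : ℝ} (hM : ∀ x y, ‖K x y‖ ≤ M) {f : β → ℂ} (hf : Integrable f ν)
    (x : α) : ‖∫ y, K x y * f y ∂ν‖ ≤ M * ∫ y, ‖f y‖ ∂ν := by
  rw [← integral_const_mul]
  refine norm_integral_le_of_norm_le (hf.norm.const_mul M) (Filter.Eventually.of_forall fun y ↦ ?_)
  rw [norm_mul]
  gcongr
  exact hM x y

section
variable {α β : Type*} [MeasurableSpace α] [MeasurableSpace β]
  {μ : Measure α} {ν : Measure β} {K : α → β → ℂ} {M : ℝ}

theorem stronglyMeasurable_kernel_integral [SFinite ν]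
    (hK : StronglyMeasurable (Function.uncurry K)) {f : β → ℂ} (hf : AEStronglyMeasurable f ν) :
    StronglyMeasurable fun x ↦ ∫ y, K x y * f y ∂ν := by
  have : (fun x ↦ ∫ y, K x y * f y ∂ν) = fun x ↦ ∫ y, K x y * hf.mk f y ∂ν := by
    ext x
    refine integral_congr_ae ?_
    filter_upwards [hf.ae_eq_mk] with y hy
    rw [hy]
  rw [this]
  refine StronglyMeasurable.integral_prod_right (f := fun x y ↦ K x y * hf.mk f y) ?_
  exact hK.mul (hf.stronglyMeasurable_mk.comp_measurable measurable_snd)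

/-- For simple `f` and `g` the form is a finite combination of the products `φ (c') * φ (c)`, whose
coefficients do not depend on `φ`. For a holomorphic family of `φ` this shows that the form is
holomorphic, with no differentiation under the integral sign. -/
theorem kernelForm_comp_eq_sum [SFinite ν] (hK : StronglyMeasurable (Function.uncurry K))
    (hM : ∀ x y, ‖K x y‖ ≤ M) (f : SimpleFunc β ℂ) (hf : Integrable f ν) (g : SimpleFunc α ℂ)
    (hg : Integrable g μ) {φ : ℂ → ℂ} (h0 : φ 0 = 0) :
    kernelForm μ ν K (fun y ↦ φ (f y)) (fun x ↦ φ (g x)) =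
      ∑ c' ∈ g.range with c' ≠ 0, ∑ c ∈ f.range with c ≠ 0,
        φ c' * (φ c * ∫ x in g ⁻¹' {c'}, ∫ y in f ⁻¹' {c}, K x y ∂ν ∂μ) := by
  have hKx : ∀ x, AEStronglyMeasurable (K x) ν := fun x ↦
    (hK.comp_measurable measurable_prodMk_left).aestronglyMeasurable
  have hfφ : Integrable (fun y ↦ φ (f y)) ν := by
    have : (fun y ↦ φ (f y)) = f.map φ := rfl
    rw [this]
    exact SimpleFunc.integrable_iff_finMeasSupp.2
      ((SimpleFunc.integrable_iff_finMeasSupp.1 hf).map h0)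
  have hs : StronglyMeasurable fun x ↦ ∫ y, K x y * φ (f y) ∂ν :=
    stronglyMeasurable_kernel_integral hK hfφ.1
  unfold kernelForm
  rw [g.integral_mul_comp_eq_sum hg hs.aestronglyMeasurable (norm_kernel_integral_le hM hfφ) h0]
  refine Finset.sum_congr rfl fun c' hc' ↦ ?_
  rw [← Finset.mul_sum]
  congr 1
  simp_rw [fun x ↦ f.integral_mul_comp_eq_sum hf (hKx x) (hM x) h0]
  rw [integral_finsetSum]
  · simp_rw [integral_const_mul]
  · intro c hc
    simp only [Finset.mem_filter] at hc hc'
    have hfin := SimpleFunc.measure_preimage_lt_top_of_integrable f hf hc.2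
    refine Integrable.const_mul (f := fun x ↦ ∫ y in f ⁻¹' {c}, K x y ∂ν)
      (Measure.integrableOn_of_bounded (M := M * ν.real (f ⁻¹' {c}))
      (SimpleFunc.measure_preimage_lt_top_of_integrable g hg hc'.2).ne ?_
      (Filter.Eventually.of_forall fun x ↦ ?_)) _
    · exact (StronglyMeasurable.integral_prod_right (f := K) hK).aestronglyMeasurable
    · exact norm_setIntegral_le_of_norm_le_const hfin fun y _ ↦ hM x y

end

/-- The analytic family `ζ ↦ (c / |c|) |c| ^ (p (1 - ζ / 2))`, with value `0` at `c = 0`. Its modulus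
is `|c| ^ p` for `re ζ = 0` and `|c| ^ (p / 2)` for `re ζ = 1`, so composition with it carries `Lᵖ`
into `L¹` and into `L²` on the two edges of the strip; at `ζ = 2 - 2 / p` it is the identity in `c`. -/
noncomputable def phasePow (p : ℝ) (ζ c : ℂ) : ℂ :=
  (c / ‖c‖) * exp (p * (1 - ζ / 2) * Real.log ‖c‖)

theorem phasePow_zero (p : ℝ) (ζ : ℂ) : phasePow p ζ 0 = 0 := by simp [phasePow]

theorem norm_phasePow (p : ℝ) (ζ : ℂ) {c : ℂ} (hc : c ≠ 0) :
    ‖phasePow p ζ c‖ = ‖c‖ ^ (p * (1 - ζ.re / 2)) := by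
  have : ‖c‖ ≠ 0 := norm_ne_zero_iff.2 hc
  rw [phasePow, norm_mul, norm_div, norm_real, norm_norm, div_self this, one_mul, norm_exp,
    Real.rpow_def_of_pos (norm_pos_iff.2 hc)]
  congr 1
  rw [re_mul_ofReal, re_ofReal_mul, mul_comm]
  congr 2
  rw [sub_re, one_re, show ζ / 2 = ζ / ((2 : ℝ) : ℂ) by norm_num, div_ofReal_re]

/-- The condition on `r` says that `r` is the exponent `1 / (1 - re ζ / 2)` attached to the vertical
line through `ζ`. -/
theorem norm_phasePow_rpow {p : ℝ} (hp : 0 < p) {ζ : ℂ} {r : ℝ} (hr : r ≠ 0)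
    (h : (1 - ζ.re / 2) * r = 1) (c : ℂ) : ‖phasePow p ζ c‖ ^ r = ‖c‖ ^ p := by
  rcases eq_or_ne c 0 with rfl | hc
  · simp [phasePow_zero, Real.zero_rpow hr, Real.zero_rpow hp.ne']
  · rw [norm_phasePow p ζ hc, ← Real.rpow_mul (norm_nonneg _), mul_assoc, h, mul_one]

theorem phasePow_eq_self {p : ℝ} (hp : 0 < p) (c : ℂ) :
    phasePow p ((2 - 2 / p : ℝ) : ℂ) c = c := by
  rcases eq_or_ne c 0 with rfl | hc
  · exact phasePow_zero _ _
  · have h : (p : ℂ) * (1 - ((2 - 2 / p : ℝ) : ℂ) / 2) = 1 := by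
      have : (p : ℂ) ≠ 0 := by exact_mod_cast hp.ne'
      push_cast
      field_simp
      ring
    have hn : (‖c‖ : ℂ) ≠ 0 := by exact_mod_cast norm_ne_zero_iff.2 hc
    rw [phasePow, h, one_mul, ← ofReal_exp, Real.exp_log (norm_pos_iff.2 hc), div_mul_cancel₀ _ hn]

theorem differentiable_phasePow (p : ℝ) (c : ℂ) : Differentiable ℂ fun ζ ↦ phasePow p ζ c := by
  unfold phasePow
  fun_prop

theorem norm_phasePow_le {p : ℝ} (hp : 0 ≤ p) {ζ : ℂ} (h0 : 0 ≤ ζ.re) (h1 : ζ.re ≤ 1) {c : ℂ}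
    (hc : c ≠ 0) : ‖phasePow p ζ c‖ ≤ (1 + ‖c‖) ^ p := by
  rw [norm_phasePow p ζ hc]
  have := norm_nonneg c
  calc ‖c‖ ^ (p * (1 - ζ.re / 2)) ≤ (1 + ‖c‖) ^ (p * (1 - ζ.re / 2)) := by
        apply Real.rpow_le_rpow <;> nlinarith
    _ ≤ (1 + ‖c‖) ^ p := by
        apply Real.rpow_le_rpow_of_exponent_le <;> nlinarith

section
variable {α β : Type*} [MeasurableSpace α] [MeasurableSpace β]
  {μ : Measure α} {ν : Measure β} {K : α → β → ℂ} {M : ℝ}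

/-- Interpolation for the bilinear form: Hadamard's three lines theorem, applied to
`ζ ↦ kernelForm (phasePow p ζ ∘ f) (phasePow p ζ ∘ g)`, which is the form at `(f, g)` for
`ζ = 2 - 2 / p`. -/
theorem norm_kernelForm_le_interpolation [SFinite ν]
    (hK : StronglyMeasurable (Function.uncurry K)) (hM : ∀ x y, ‖K x y‖ ≤ M) (hM0 : 0 ≤ M)
    (h2 : ∀ (u : SimpleFunc β ℂ) (v : SimpleFunc α ℂ), Integrable u ν → Integrable v μ →
      ‖kernelForm μ ν K u v‖ ≤
        (∫ y, ‖u y‖ ^ (2 : ℝ) ∂ν) ^ (1 / 2 : ℝ) * (∫ x, ‖v x‖ ^ (2 : ℝ) ∂μ) ^ (1 / 2 : ℝ))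
    {p : ℝ} (hp1 : 1 ≤ p) (hp2 : p ≤ 2)
    (f : SimpleFunc β ℂ) (hf : Integrable f ν) (g : SimpleFunc α ℂ) (hg : Integrable g μ) :
    ‖kernelForm μ ν K f g‖ ≤
      M ^ (2 / p - 1) * (∫ y, ‖f y‖ ^ p ∂ν) ^ (1 / p) * (∫ x, ‖g x‖ ^ p ∂μ) ^ (1 / p) := by
  have hp : 0 < p := by linarith
  set F : ℂ → ℂ := fun ζ ↦
    kernelForm μ ν K (fun y ↦ phasePow p ζ (f y)) (fun x ↦ phasePow p ζ (g x)) with hF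
  have hsum : ∀ ζ, F ζ = ∑ c' ∈ g.range with c' ≠ 0, ∑ c ∈ f.range with c ≠ 0,
      phasePow p ζ c' * (phasePow p ζ c *
        ∫ x in g ⁻¹' {c'}, ∫ y in f ⁻¹' {c}, K x y ∂ν ∂μ) := fun ζ ↦
    kernelForm_comp_eq_sum hK hM f hf g hg (phasePow_zero p ζ)
  have hfi : ∀ ζ, Integrable (f.map (phasePow p ζ)) ν := fun ζ ↦
    SimpleFunc.integrable_iff_finMeasSupp.2
      ((SimpleFunc.integrable_iff_finMeasSupp.1 hf).map (phasePow_zero p ζ))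
  have hgi : ∀ ζ, Integrable (g.map (phasePow p ζ)) μ := fun ζ ↦
    SimpleFunc.integrable_iff_finMeasSupp.2
      ((SimpleFunc.integrable_iff_finMeasSupp.1 hg).map (phasePow_zero p ζ))
  have hd : Differentiable ℂ F := by
    have : F = fun ζ ↦ _ := funext hsum
    rw [this]
    have := differentiable_phasePow p
    fun_prop
  set A : ℝ := ∫ y, ‖f y‖ ^ p ∂ν with hA
  set B : ℝ := ∫ x, ‖g x‖ ^ p ∂μ with hB
  have hA0 : 0 ≤ A := integral_nonneg fun y ↦ by positivity
  have hB0 : 0 ≤ B := integral_nonneg fun y ↦ by positivity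
  set t : ℝ := 2 - 2 / p with ht
  have hdiv1 : 2 / p ≤ 2 := by rw [div_le_iff₀ hp]; linarith
  have hdiv2 : 1 ≤ 2 / p := by rw [le_div_iff₀ hp]; linarith
  have key := HadamardThreeLines.norm_le_interp_of_mem_verticalClosedStrip₀₁' F (z := (t : ℂ))
    (a := M * A * B) (b := A ^ (1 / 2 : ℝ) * B ^ (1 / 2 : ℝ)) ?_ hd.diffContOnCl ?_ ?_ ?_
  · have hFt : F t = kernelForm μ ν K f g := by
      simp only [hF, ht, phasePow_eq_self hp]
    rw [hFt, ofReal_re] at key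
    refine key.trans_eq ?_
    have h1t : 1 - t = 2 / p - 1 := by rw [ht]; ring
    have hsplit : ∀ X : ℝ, 0 ≤ X → X ^ (1 - t) * (X ^ (1 / 2 : ℝ)) ^ t = X ^ (1 / p) := by
      intro X hX
      rw [← Real.rpow_mul hX, ← Real.rpow_add' hX]
      · congr 1
        rw [ht]; ring
      -- `Real.rpow_add'` also covers `X = 0`, as the total exponent is not zero
      · rw [ht, show 1 - (2 - 2 / p) + 1 / 2 * (2 - 2 / p) = 1 / p by ring]
        positivity
    rw [Real.mul_rpow (by positivity) hB0, Real.mul_rpow hM0 hA0,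
      Real.mul_rpow (by positivity) (by positivity), ← hsplit A hA0, ← hsplit B hB0, h1t]
    ring
  · simp only [HadamardThreeLines.verticalClosedStrip, Set.mem_preimage, ofReal_re, Set.mem_Icc, ht]
    constructor <;> linarith
  · refine ⟨∑ c' ∈ g.range with c' ≠ 0, ∑ c ∈ f.range with c ≠ 0,
      (1 + ‖c'‖) ^ p * ((1 + ‖c‖) ^ p *
        ‖∫ x in g ⁻¹' {c'}, ∫ y in f ⁻¹' {c}, K x y ∂ν ∂μ‖), ?_⟩
    rintro _ ⟨ζ, ⟨h0, h1⟩, rfl⟩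
    simp only [Function.comp_apply, hsum]
    refine norm_sum_le_of_le _ fun c' hc' ↦ norm_sum_le_of_le _ fun c hc ↦ ?_
    simp only [Finset.mem_filter] at hc hc'
    rw [norm_mul, norm_mul]
    gcongr
    · exact norm_phasePow_le hp.le h0 h1 hc'.2
    · exact norm_phasePow_le hp.le h0 h1 hc.2
  -- the edge `re ζ = 0`: the `L¹ → L^∞` bound
  · intro ζ hζ
    have hζ' : (1 - ζ.re / 2) * 1 = 1 := by
      rw [show ζ.re = 0 from hζ]; norm_num
    have e1 : ∀ c, ‖phasePow p ζ c‖ = ‖c‖ ^ p := fun c ↦ by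
      rw [← norm_phasePow_rpow hp one_ne_zero hζ', Real.rpow_one]
    have hfn : ∫ y, ‖f.map (phasePow p ζ) y‖ ∂ν = A := by
      simp only [SimpleFunc.map_apply, e1, hA]
    have hgn : ∫ x, ‖g.map (phasePow p ζ) x‖ ∂μ = B := by
      simp only [SimpleFunc.map_apply, e1, hB]
    rw [← hfn, ← hgn, ← integral_const_mul]
    refine norm_integral_le_of_norm_le ((hgi ζ).norm.const_mul _)
      (Filter.Eventually.of_forall fun x ↦ ?_)
    rw [norm_mul]
    gcongr
    · exact norm_kernel_integral_le hM (hfi ζ) x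
    · exact le_rfl
  -- the edge `re ζ = 1`: the `L² → L²` bound
  · intro ζ hζ
    have hζ' : (1 - ζ.re / 2) * 2 = 1 := by
      rw [show ζ.re = 1 from hζ]; norm_num
    have := h2 _ _ (hfi ζ) (hgi ζ)
    simp only [SimpleFunc.map_apply, norm_phasePow_rpow hp two_ne_zero hζ'] at this
    exact this

end

/-! ### Duality and density -/

/-- The converse of Hölder's inequality, tested on simple functions only: `h ∈ L^q` is assumed, so
`g ↦ ∫ h g` is continuous on `Lᵖ` and the hypothesis passes from simple functions to the extremal
function. -/
theorem eLpNorm_le_of_forall_simpleFunc {α : Type*} [MeasurableSpace α] {μ : Measure α}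
    {p q : ENNReal} [Fact (1 ≤ p)] [Fact (1 ≤ q)] [p.HolderConjugate q] (hp : 1 < p.toReal)
    {h : α → ℂ} (hh : MemLp h q μ) {C : ℝ} (hC : 0 ≤ C)
    (H : ∀ g : SimpleFunc α ℂ, MemLp g p μ →
      ‖∫ x, h x * g x ∂μ‖ ≤ C * (∫ x, ‖g x‖ ^ p.toReal ∂μ) ^ (1 / p.toReal)) :
    eLpNorm h q μ ≤ ENNReal.ofReal C := by
  have hpq := ENNReal.HolderConjugate.toReal (q := q) hp
  have hpt : p ≠ ⊤ := fun h ↦ by norm_num [h] at hp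
  have hqt : q ≠ ⊤ := fun h ↦ by simpa [h] using hpq.symm.pos
  have hp0 : p ≠ 0 := fun h ↦ by norm_num [h] at hp
  have hq0 : q ≠ 0 := fun h ↦ by simpa [h] using hpq.symm.pos
  have : q.HolderConjugate p := ENNReal.HolderConjugate.symm
  have norm_eq : ∀ {g : α → ℂ} (hg : MemLp g p μ), ‖hg.toLp g‖ =
      (∫ x, ‖g x‖ ^ p.toReal ∂μ) ^ (1 / p.toReal) := fun {g} hg ↦ by
    rw [Lp.norm_toLp, hg.eLpNorm_eq_integral_rpow_norm hp0 hpt, ENNReal.toReal_ofReal (by positivity),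
      one_div]
  let L : Lp ℂ p μ →L[ℂ] ℂ := (ContinuousLinearMap.mul ℂ ℂ).lpPairing μ q p (hh.toLp h)
  have hL : ∀ {g : α → ℂ} (hg : MemLp g p μ), L (hg.toLp g) = ∫ x, h x * g x ∂μ := fun {g} hg ↦ by
    simp only [L, ContinuousLinearMap.lpPairing_eq_integral, ContinuousLinearMap.mul_apply']
    refine integral_congr_ae ?_
    filter_upwards [hh.coeFn_toLp, hg.coeFn_toLp] with x h1 h2
    rw [h1, h2]
  have hbound : ∀ g : Lp ℂ p μ, ‖L g‖ ≤ C * ‖g‖ := by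
    intro g
    refine (Lp.simpleFunc.denseRange (E := ℂ) (μ := μ) hpt).induction_on g
      (isClosed_le (by fun_prop) (by fun_prop)) fun s ↦ ?_
    have hs := Lp.simpleFunc.memLp s
    have e : (s : Lp ℂ p μ) = hs.toLp _ := by
      rw [← Lp.simpleFunc.toLp_eq_toLp, Lp.simpleFunc.toLp_toSimpleFunc]
    rw [e, hL, norm_eq]
    exact H _ hs
  -- the extremal function: `h g = |h| ^ q` and `|g| ^ p = |h| ^ q`; where `h = 0`, the factor
  -- `conj h` makes the value of the power irrelevant
  let g : α → ℂ := fun x ↦ (starRingEnd ℂ) (h x) * ((‖h x‖ ^ (q.toReal - 2) : ℝ) : ℂ)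
  have hng : ∀ x, ‖g x‖ = ‖h x‖ ^ (q.toReal - 1) := by
    intro x
    rcases eq_or_ne (h x) 0 with h0 | h0
    · simp [g, h0, Real.zero_rpow (sub_pos.2 hpq.symm.lt).ne']
    · simp only [g, norm_mul, RCLike.norm_conj, norm_real]
      rw [Real.norm_of_nonneg (by positivity), ← Real.rpow_one_add' (norm_nonneg _)]
      · congr 1; ring
      · linarith [hpq.symm.lt]
  have hngp : ∀ x, ‖g x‖ ^ p.toReal = ‖h x‖ ^ q.toReal := fun x ↦ by
    rw [hng, ← Real.rpow_mul (norm_nonneg _), hpq.symm.sub_one_mul_conj]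
  have hhg : ∀ x, h x * g x = ((‖h x‖ ^ q.toReal : ℝ) : ℂ) := fun x ↦ by
    simp only [g]
    rw [← mul_assoc, mul_conj, ← ofReal_mul, normSq_eq_norm_sq, ← Real.rpow_natCast,
      ← Real.rpow_add' (norm_nonneg _)]
    · congr 2; norm_num
    · norm_num; exact hpq.symm.ne_zero
  have hgm : AEStronglyMeasurable g μ :=
    (continuous_conj.comp_aestronglyMeasurable hh.1).mul
      (continuous_ofReal.comp_aestronglyMeasurable
        ((hh.1.norm.aemeasurable.pow_const _).aestronglyMeasurable))
  have hg : MemLp g p μ := by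
    rw [← integrable_norm_rpow_iff hgm hp0 hpt]
    simp_rw [hngp]
    exact hh.integrable_norm_rpow hq0 hqt
  have key := hbound (hg.toLp g)
  set S : ℝ := ∫ x, ‖h x‖ ^ q.toReal ∂μ with hS
  have hS0 : 0 ≤ S := integral_nonneg fun x ↦ by positivity
  rw [hL, norm_eq] at key
  simp_rw [hngp, hhg] at key
  rw [integral_complex_ofReal, norm_real, Real.norm_of_nonneg hS0] at key
  rw [hh.eLpNorm_eq_integral_rpow_norm hq0 hqt]
  refine ENNReal.ofReal_le_ofReal ?_
  rcases hS0.eq_or_lt with h0 | h0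
  · rw [← hS, ← h0, Real.zero_rpow (inv_ne_zero hpq.symm.ne_zero)]
    exact hC
  · refine le_of_mul_le_mul_right ?_ (Real.rpow_pos_of_pos h0 (1 / p.toReal))
    rw [← hS, ← Real.rpow_add h0, one_div, add_comm, hpq.inv_add_inv_eq_one, Real.rpow_one,
      ← one_div]
    exact key

theorem MeasureTheory.MemLp.of_bounded_of_two_le {α : Type*} [MeasurableSpace α] {μ : Measure α}
    {h : α → ℂ} {q : ENNReal} (h2 : MemLp h 2 μ) {C : ℝ} (hC : ∀ x, ‖h x‖ ≤ C) (hq : 2 ≤ q.toReal)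
    (hqt : q ≠ ⊤) : MemLp h q μ := by
  have hq0 : q ≠ 0 := fun h ↦ by norm_num [h] at hq
  rw [← integrable_norm_rpow_iff h2.1 hq0 hqt]
  have h2' := h2.integrable_norm_rpow (by norm_num) (by norm_num)
  refine (h2'.const_mul (C ^ (q.toReal - 2))).mono'
    (h2.1.norm.aemeasurable.pow_const _).aestronglyMeasurable (Filter.Eventually.of_forall fun x ↦ ?_)
  rw [Real.norm_of_nonneg (by positivity)]
  calc ‖h x‖ ^ q.toReal = ‖h x‖ ^ (q.toReal - 2) * ‖h x‖ ^ (2 : ℝ) := by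
        rw [← Real.rpow_add' (norm_nonneg _)]
        · congr 1; ring
        · linarith
    _ ≤ _ := by
        simp only [ENNReal.toReal_ofNat]
        gcongr
        exact hC x

section
variable {α β : Type*} [MeasurableSpace α] [MeasurableSpace β]
  {μ : Measure α} {ν : Measure β} {K : α → β → ℂ} {M : ℝ}

/-- The interpolated bound on simple functions, for `1 < p ≤ 2`. The integral of a simple function
is bounded and square integrable, hence in `L^q` as `2 ≤ q`, so duality applies. -/
theorem eLpNorm_kernel_integral_simpleFunc_le [SFinite ν]
    (hK : StronglyMeasurable (Function.uncurry K)) (hM : ∀ x y, ‖K x y‖ ≤ M) (hM0 : 0 ≤ M)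
    (h2 : ∀ u : SimpleFunc β ℂ, Integrable u ν →
      eLpNorm (fun x ↦ ∫ y, K x y * u y ∂ν) 2 μ ≤ eLpNorm u 2 ν)
    {p q : ENNReal} [Fact (1 ≤ p)] [Fact (1 ≤ q)] [p.HolderConjugate q] (hp1 : 1 < p.toReal)
    (hp2 : p ≤ 2) (f : SimpleFunc β ℂ) (hf : Integrable f ν) :
    eLpNorm (fun x ↦ ∫ y, K x y * f y ∂ν) q μ ≤
      ENNReal.ofReal (M ^ (2 / p.toReal - 1)) * eLpNorm f p ν := by
  have hpq := ENNReal.HolderConjugate.toReal (q := q) hp1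
  have hpt : p ≠ ⊤ := fun h ↦ by norm_num [h] at hp1
  have hqt : q ≠ ⊤ := fun h ↦ by simpa [h] using hpq.symm.pos
  have hp0 : p ≠ 0 := fun h ↦ by norm_num [h] at hp1
  have hp2' : p.toReal ≤ 2 := by
    simpa using ENNReal.toReal_mono (by norm_num) hp2
  have hq2 : 2 ≤ q.toReal := by
    rw [hpq.conjugate_eq, le_div_iff₀ (by linarith)]
    linarith
  have hmem2 : ∀ u : SimpleFunc β ℂ, Integrable u ν →
      MemLp (fun x ↦ ∫ y, K x y * u y ∂ν) 2 μ := fun u hu ↦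
    ⟨(stronglyMeasurable_kernel_integral hK hu.1).aestronglyMeasurable, (h2 u hu).trans_lt
      ((SimpleFunc.memLp_iff_integrable (by norm_num) (by norm_num)).2 hu).2⟩
  have hform : ∀ (u : SimpleFunc β ℂ) (v : SimpleFunc α ℂ), Integrable u ν → Integrable v μ →
      ‖kernelForm μ ν K u v‖ ≤
        (∫ y, ‖u y‖ ^ (2 : ℝ) ∂ν) ^ (1 / 2 : ℝ) *
          (∫ x, ‖v x‖ ^ (2 : ℝ) ∂μ) ^ (1 / 2 : ℝ) := by
    intro u v hu hv
    have hu2 : MemLp u 2 ν := (SimpleFunc.memLp_iff_integrable (by norm_num) (by norm_num)).2 hu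
    have hv2 : MemLp v 2 μ := (SimpleFunc.memLp_iff_integrable (by norm_num) (by norm_num)).2 hv
    have hT := h2 u hu
    rw [(hmem2 u hu).eLpNorm_eq_integral_rpow_norm (by norm_num) (by norm_num),
      hu2.eLpNorm_eq_integral_rpow_norm (by norm_num) (by norm_num),
      ENNReal.ofReal_le_ofReal_iff (by positivity)] at hT
    simp only [ENNReal.toReal_ofNat, ← one_div] at hT
    refine (norm_integral_le_integral_norm _).trans ?_
    simp_rw [norm_mul]
    refine (integral_mul_norm_le_Lp_mul_Lq Real.HolderConjugate.two_two
      (by simpa using hmem2 u hu) (by simpa using hv2)).trans ?_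
    gcongr
  set N : ℝ := (∫ y, ‖f y‖ ^ p.toReal ∂ν) ^ (1 / p.toReal) with hN
  have hfp : MemLp f p ν := (SimpleFunc.memLp_iff_integrable hp0 hpt).2 hf
  rw [hfp.eLpNorm_eq_integral_rpow_norm hp0 hpt, ← one_div, ← hN,
    ← ENNReal.ofReal_mul (by positivity)]
  refine eLpNorm_le_of_forall_simpleFunc hp1
    ((hmem2 f hf).of_bounded_of_two_le (norm_kernel_integral_le hM hf) hq2 hqt) (by positivity)
    fun g hg ↦ ?_
  exact norm_kernelForm_le_interpolation hK hM hM0 hform hp1.le hp2' f hf g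
    ((SimpleFunc.memLp_iff_integrable hp0 hpt).1 hg)

/-- Passage from simple functions to `L¹ ∩ Lᵖ`. One sequence of simple functions converges to `f` in
both `L¹` and `Lᵖ`; the integrals converge pointwise because the kernel is bounded, and Fatou's lemma
for the `L^q` norm gives the bound in the limit. -/
theorem eLpNorm_kernel_integral_le_of_simpleFunc [SFinite ν]
    (hK : StronglyMeasurable (Function.uncurry K)) (hM : ∀ x y, ‖K x y‖ ≤ M)
    {p q : ENNReal} (hpt : p ≠ ⊤) (hp1 : 1 ≤ p) {C : ENNReal} (hC : C ≠ ⊤)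
    (H : ∀ u : SimpleFunc β ℂ, Integrable u ν →
      eLpNorm (fun x ↦ ∫ y, K x y * u y ∂ν) q μ ≤ C * eLpNorm u p ν)
    {f : β → ℂ} (hf : Integrable f ν) (hfp : MemLp f p ν) :
    eLpNorm (fun x ↦ ∫ y, K x y * f y ∂ν) q μ ≤ C * eLpNorm f p ν := by
  wlog hfm : Measurable f generalizing f
  · have hae := hf.1.ae_eq_mk
    have := this (hf.congr hae) ((memLp_congr_ae hae).1 hfp) hf.1.stronglyMeasurable_mk.measurable
    rw [eLpNorm_congr_ae hae]
    convert! this using 3 with x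
    refine integral_congr_ae ?_
    filter_upwards [hae] with y hy
    rw [hy]
  let s : ℕ → SimpleFunc β ℂ := fun n ↦
    SimpleFunc.approxOn f hfm (Set.range f ∪ {0}) 0 (by simp) n
  have hs : ∀ n, Integrable (s n) ν := fun n ↦ SimpleFunc.integrable_approxOn_range hfm hf n
  have hs1 := SimpleFunc.tendsto_approxOn_range_L1_enorm hfm hf
  have hsp := SimpleFunc.tendsto_approxOn_range_Lp_eLpNorm hpt hfm hfp.2
  have hKi : ∀ {u : β → ℂ}, Integrable u ν → ∀ x, Integrable (fun y ↦ K x y * u y) ν :=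
    fun hu x ↦ hu.bdd_mul (hK.comp_measurable measurable_prodMk_left).aestronglyMeasurable
      (Filter.Eventually.of_forall (hM x))
  have hlim : ∀ x, Filter.Tendsto (fun n ↦ ∫ y, K x y * s n y ∂ν) Filter.atTop
      (nhds (∫ y, K x y * f y ∂ν)) := by
    intro x
    refine tendsto_integral_of_L1 _ (hKi hf x).1 (Filter.Eventually.of_forall fun n ↦ hKi (hs n) x) ?_
    have hs1' := ENNReal.Tendsto.const_mul (a := ENNReal.ofReal M) hs1 (Or.inr ENNReal.ofReal_ne_top)
    rw [mul_zero] at hs1'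
    refine tendsto_of_tendsto_of_tendsto_of_le_of_le tendsto_const_nhds hs1' (fun _ ↦ zero_le)
      fun n ↦ ?_
    dsimp only
    rw [← lintegral_const_mul' _ _ ENNReal.ofReal_ne_top]
    refine lintegral_mono fun y ↦ ?_
    rw [← mul_sub, enorm_mul]
    gcongr
    rw [← ofReal_norm]
    exact ENNReal.ofReal_le_ofReal (hM x y)
  refine (Lp.eLpNorm_lim_le_liminf_eLpNorm (fun n ↦
    (stronglyMeasurable_kernel_integral hK (hs n).1).aestronglyMeasurable) _
    (Filter.Eventually.of_forall hlim)).trans ?_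
  have hup : Filter.Tendsto (fun n ↦ C * (eLpNorm (⇑(s n) - f) p ν + eLpNorm f p ν))
      Filter.atTop (nhds (C * (0 + eLpNorm f p ν))) :=
    ENNReal.Tendsto.const_mul (hsp.add_const _) (Or.inr hC)
  rw [zero_add] at hup
  rw [← hup.liminf_eq]
  refine Filter.liminf_le_liminf (Filter.Eventually.of_forall fun n ↦ (H _ (hs n)).trans ?_)
  gcongr
  calc eLpNorm (s n) p ν = eLpNorm (⇑(s n) - f + f) p ν := by simp
    _ ≤ _ := eLpNorm_add_le ((hs n).1.sub hf.1) hf.1 hp1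

/-- **Riesz–Thorin interpolation** between `L¹ → L^∞` and `L² → L²` for an integral operator with
bounded kernel. -/
theorem eLpNorm_kernel_integral_le [SFinite ν]
    (hK : StronglyMeasurable (Function.uncurry K)) (hM : ∀ x y, ‖K x y‖ ≤ M) (hM0 : 0 ≤ M)
    (h2 : ∀ u : SimpleFunc β ℂ, Integrable u ν →
      eLpNorm (fun x ↦ ∫ y, K x y * u y ∂ν) 2 μ ≤ eLpNorm u 2 ν)
    {p q : ENNReal} [Fact (1 ≤ p)] [Fact (1 ≤ q)] [hpq : p.HolderConjugate q] (hp2 : p ≤ 2)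
    {f : β → ℂ} (hf : Integrable f ν) (hfp : MemLp f p ν) :
    eLpNorm (fun x ↦ ∫ y, K x y * f y ∂ν) q μ ≤
      ENNReal.ofReal (M ^ (2 / p.toReal - 1)) * eLpNorm f p ν := by
  have hp1 : 1 ≤ p := Fact.out
  have hpt : p ≠ ⊤ := (hp2.trans_lt (by norm_num)).ne
  rcases hp1.eq_or_lt with rfl | hp
  · obtain rfl : q = ⊤ := ENNReal.HolderConjugate.unique 1 q ⊤
    have e : (2 / (1 : ENNReal).toReal - 1 : ℝ) = 1 := by norm_num
    rw [e, Real.rpow_one, eLpNorm_one_eq_lintegral_enorm, ← ofReal_integral_norm_eq_lintegral_enorm hf,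
      ← ENNReal.ofReal_mul hM0, eLpNorm_exponent_top]
    exact eLpNormEssSup_le_of_ae_bound (Filter.Eventually.of_forall (norm_kernel_integral_le hM hf))
  · have hp' : 1 < p.toReal := by
      simpa using (ENNReal.toReal_lt_toReal (by norm_num) hpt).2 hp
    exact eLpNorm_kernel_integral_le_of_simpleFunc hK hM hpt hp1 ENNReal.ofReal_ne_top
      (fun u hu ↦ eLpNorm_kernel_integral_simpleFunc_le hK hM hM0 h2 hp' hp2 u hu) hf hfp

end

/-! ### The Fourier integral on `L¹ ∩ L²` -/

/-- Self-adjointness of the Fourier transform for the bilinear pairing. -/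
theorem Real.integral_fourier_mul_eq {f g : ℝ → ℂ} (hf : Integrable f) (hg : Integrable g) :
    ∫ ξ, 𝓕 f ξ * g ξ = ∫ x, f x * 𝓕 g x := by
  simpa using! (VectorFourier.integral_fourierIntegral_smul_eq_flip (L := innerₗ ℝ)
    Real.continuous_fourierChar continuous_inner hf hg)

theorem continuous_fourier_of_integrable {f : ℝ → ℂ} (hf : Integrable f) : Continuous (𝓕 f) :=
  VectorFourier.fourierIntegral_continuous Real.continuous_fourierChar
    (by exact continuous_inner) hf

/-- On `L¹ ∩ L²` the Fourier transform of `L²` is given by the Fourier integral: both functions have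
the same integral against every test function, since the `L²` transform is the one of tempered
distributions and the Fourier integral is self-adjoint. -/
theorem MeasureTheory.MemLp.coeFn_fourier_toLp {f : ℝ → ℂ} (hf : Integrable f)
    (hf2 : MemLp f 2) : (𝓕 (hf2.toLp f) : Lp ℂ 2 (volume : Measure ℝ)) =ᵐ[volume] 𝓕 f := by
  refine ae_eq_of_integral_contDiff_smul_eq
    ((Lp.memLp _).locallyIntegrable (by norm_num))
    (continuous_fourier_of_integrable hf).locallyIntegrable fun g hg hgc ↦ ?_
  have hgc' : HasCompactSupport fun x ↦ (g x : ℂ) := hgc.comp_left ofReal_zero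
  have hg' : ContDiff ℝ (⊤ : ℕ∞) fun x ↦ (g x : ℂ) := ofRealCLM.contDiff.comp hg
  let φ : 𝓢(ℝ, ℂ) := hgc'.toSchwartzMap hg'
  have h := congrArg (fun T ↦ T φ) (Lp.fourier_toTemperedDistribution_eq (hf2.toLp f))
  simp only [TemperedDistribution.fourier_apply, Lp.toTemperedDistribution_apply] at h
  have hφ : ∀ x, φ x = (g x : ℂ) := fun x ↦ rfl
  simp only [hφ] at h
  simp only [real_smul]
  refine h.symm.trans ?_
  have h3 := Real.integral_fourier_mul_eq hf φ.integrable
  simp only [hφ, ← SchwartzMap.fourier_coe] at h3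
  simp_rw [mul_comm (g _ : ℂ)]
  rw [h3]
  refine integral_congr_ae ?_
  filter_upwards [hf2.coeFn_toLp] with x hx
  rw [hx, smul_eq_mul, mul_comm]

/-- **Plancherel's theorem** for the Fourier integral on `L¹ ∩ L²`. -/
theorem eLpNorm_fourier_eq {f : ℝ → ℂ} (hf : Integrable f) (hf2 : MemLp f 2) :
    eLpNorm (𝓕 f) 2 volume = eLpNorm f 2 volume := by
  rw [← eLpNorm_congr_ae (MemLp.coeFn_fourier_toLp hf hf2), ← eLpNorm_congr_ae hf2.coeFn_toLp]
  have := congrArg ENNReal.ofReal (Lp.norm_fourier_eq (hf2.toLp f))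
  rwa [ofReal_norm, ofReal_norm, Lp.enorm_def, Lp.enorm_def] at this

theorem eLpNorm_comp_mul_left {g : ℝ → ℂ} (hg : AEStronglyMeasurable g) {r : ℝ} (hr : r ≠ 0)
    {p : ENNReal} (hp : p ≠ ⊤) :
    eLpNorm (fun x ↦ g (r * x)) p volume =
      ENNReal.ofReal |r⁻¹| ^ (1 / p.toReal) * eLpNorm g p volume := by
  have hm := Real.map_volume_mul_left hr
  have h := eLpNorm_map_measure (p := p) (μ := volume) (f := fun x ↦ r * x) (g := g)
    (by rw [hm]; exact hg.smul_measure _) (by fun_prop)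
  rw [hm, eLpNorm_smul_measure_of_ne_top hp] at h
  rw [← smul_eq_mul]
  convert! h.symm using 2
  simp

/-! ### The quadratic Hartley integral -/

theorem norm_cexp_neg_I_mul_ofReal (t : ℝ) : ‖exp (-(I * (t : ℂ)))‖ = 1 := by
  rw [norm_exp]; simp

/-- Up to unimodular factors in `x` and in `y`, the integral with phase `Q` is the Fourier integral
at the frequency `b x / 2π`. -/
theorem eLpNorm_two_quadPhase_integral {b : ℝ} (a c d e : ℝ) (hb : b ≠ 0) {f : ℝ → ℂ}
    (hf : Integrable f) (hf2 : MemLp f 2) :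
    eLpNorm (fun x ↦ ∫ y, exp (-(I * (quadPhase a b c d e x y : ℂ))) * f y) 2 volume =
      ENNReal.ofReal |(b / (2 * Real.pi))⁻¹| ^ (1 / 2 : ℝ) * eLpNorm f 2 volume := by
  have hc : Continuous fun y : ℝ ↦ exp (-(I * ((c * y ^ 2 + e * y : ℝ) : ℂ))) := by fun_prop
  set w : ℝ → ℂ := fun y ↦ exp (-(I * ((c * y ^ 2 + e * y : ℝ) : ℂ))) * f y with hw
  have hwn : ∀ y, ‖w y‖ = ‖f y‖ := fun y ↦ by
    rw [hw, norm_mul, norm_cexp_neg_I_mul_ofReal, one_mul]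
  have hwm : AEStronglyMeasurable w volume := hc.aestronglyMeasurable.mul hf.1
  have hwi : Integrable w := hf.congr' hwm (Filter.Eventually.of_forall fun y ↦ (hwn y).symm)
  have hw2 : MemLp w 2 := hf2.congr_norm hwm (Filter.Eventually.of_forall fun y ↦ (hwn y).symm)
  have hr : b / (2 * Real.pi) ≠ 0 := div_ne_zero hb (by positivity)
  have key : ∀ x, ∫ y, exp (-(I * (quadPhase a b c d e x y : ℂ))) * f y =
      exp (-(I * ((a * x ^ 2 + d * x : ℝ) : ℂ))) * 𝓕 w (b / (2 * Real.pi) * x) := by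
    intro x
    rw [Real.fourier_real_eq_integral_exp_smul, ← integral_const_mul]
    refine integral_congr_ae (Filter.Eventually.of_forall fun y ↦ ?_)
    simp only [hw, smul_eq_mul, ← mul_assoc, ← exp_add]
    congr 2
    have hpi : (Real.pi : ℂ) ≠ 0 := by exact_mod_cast Real.pi_ne_zero
    simp only [quadPhase]
    push_cast
    field_simp
    ring
  calc _ = eLpNorm (fun x ↦ 𝓕 w (b / (2 * Real.pi) * x)) 2 volume := by
        refine eLpNorm_congr_norm_ae (Filter.Eventually.of_forall fun x ↦ ?_)
        rw [key, norm_mul, norm_cexp_neg_I_mul_ofReal, one_mul]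
    _ = _ := by
        rw [eLpNorm_comp_mul_left (continuous_fourier_of_integrable hwi).aestronglyMeasurable hr
          (by norm_num), eLpNorm_fourier_eq hwi hw2, ENNReal.toReal_ofNat,
          eLpNorm_congr_norm_ae (Filter.Eventually.of_forall hwn)]

theorem continuous_quadHartleyKernel (a b c d e : ℝ) (z : ℂ) :
    Continuous (Function.uncurry (quadHartleyKernel a b c d e z)) := by
  unfold quadHartleyKernel quadPhase Function.uncurry
  fun_prop

theorem norm_quadHartleyKernel_le (a b c d e : ℝ) {z : ℂ} (hz : ‖z‖ = 1) (x y : ℝ) :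
    ‖quadHartleyKernel a b c d e z x y‖ ≤ Real.sqrt (|b| / (2 * Real.pi)) := by
  rw [quadHartleyKernel, norm_mul, norm_real, Real.norm_of_nonneg (Real.sqrt_nonneg _)]
  refine mul_le_of_le_one_right (Real.sqrt_nonneg _) ?_
  rw [norm_div, show ‖(2 : ℂ)‖ = 2 by norm_num, div_le_one two_pos]
  refine (norm_add_le _ _).trans ?_
  rw [norm_mul, norm_cexp_neg_I_mul_ofReal, norm_cexp_neg_I_mul_ofReal, hz]
  norm_num

/-- The integral is half the sum of a unitary operator and a unimodular multiple of its reflection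
`x ↦ -x`, hence a contraction of `L²`. -/
theorem eLpNorm_two_quadHartleyIntegral_le {b : ℝ} (a c d e : ℝ) (hb : b ≠ 0) {z : ℂ}
    (hz : ‖z‖ = 1) {f : ℝ → ℂ} (hf : Integrable f) (hf2 : MemLp f 2) :
    eLpNorm (quadHartleyIntegral a b c d e z f) 2 volume ≤ eLpNorm f 2 volume := by
  set s : ℝ := Real.sqrt (|b| / (2 * Real.pi)) with hs
  set A : ℝ → ℂ := fun x ↦ ∫ y, exp (-(I * (quadPhase a b c d e x y : ℂ))) * f y with hA
  have hAc : Continuous (Function.uncurry fun x y ↦ exp (-(I * (quadPhase a b c d e x y : ℂ)))) := by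
    unfold quadPhase Function.uncurry
    fun_prop
  have hAm : AEStronglyMeasurable A volume :=
    (stronglyMeasurable_kernel_integral hAc.stronglyMeasurable hf.1).aestronglyMeasurable
  have hAm' : AEStronglyMeasurable (fun x ↦ A (-x)) volume :=
    ((stronglyMeasurable_kernel_integral hAc.stronglyMeasurable hf.1).comp_measurable
      measurable_neg).aestronglyMeasurable
  have hAi : ∀ x, Integrable fun y ↦ exp (-(I * (quadPhase a b c d e x y : ℂ))) * f y := fun x ↦
    hf.bdd_mul (hAc.comp (Continuous.prodMk_right x)).aestronglyMeasurable
      (Filter.Eventually.of_forall fun y ↦ (norm_cexp_neg_I_mul_ofReal _).le)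
  have hsum : quadHartleyIntegral a b c d e z f =
      (fun x ↦ (s / 2 : ℂ) * A x) + fun x ↦ (s * z / 2 : ℂ) * A (-x) := by
    ext x
    simp only [quadHartleyIntegral, Pi.add_apply, hA]
    rw [← integral_const_mul, ← integral_const_mul,
      ← integral_add ((hAi x).const_mul _) ((hAi (-x)).const_mul _)]
    refine integral_congr_ae (Filter.Eventually.of_forall fun y ↦ ?_)
    simp only [quadHartleyKernel, ← hs]
    ring
  have hneg : eLpNorm (fun x ↦ A (-x)) 2 volume = eLpNorm A 2 volume := by
    simpa using eLpNorm_comp_mul_left hAm (r := -1) (by norm_num) (p := 2) (by norm_num)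
  have hs0 : 0 ≤ s := Real.sqrt_nonneg _
  have e1 : ‖(s / 2 : ℂ)‖ₑ = ENNReal.ofReal (s / 2) := by
    rw [← ofReal_norm, norm_div, norm_real, Real.norm_of_nonneg hs0]; norm_num
  have e2 : ‖(s * z / 2 : ℂ)‖ₑ = ENNReal.ofReal (s / 2) := by
    rw [← ofReal_norm, norm_div, norm_mul, hz, norm_real, Real.norm_of_nonneg hs0]; norm_num
  have hconst : ENNReal.ofReal s * ENNReal.ofReal |(b / (2 * Real.pi))⁻¹| ^ (1 / 2 : ℝ) = 1 := by
    have h0 : 0 < |b| / (2 * Real.pi) := div_pos (abs_pos.2 hb) (by positivity)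
    rw [ENNReal.ofReal_rpow_of_nonneg (abs_nonneg _) (by norm_num), ← ENNReal.ofReal_mul hs0,
      ← Real.sqrt_eq_rpow, hs, abs_inv, abs_div, abs_of_pos (show 0 < 2 * Real.pi by positivity),
      ← Real.sqrt_mul h0.le, mul_inv_cancel₀ h0.ne', Real.sqrt_one, ENNReal.ofReal_one]
  rw [hsum]
  calc _ ≤ eLpNorm (fun x ↦ (s / 2 : ℂ) * A x) 2 volume +
        eLpNorm (fun x ↦ (s * z / 2 : ℂ) * A (-x)) 2 volume :=
        eLpNorm_add_le (hAm.const_mul _) (hAm'.const_mul _) (by norm_num)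
    _ = ENNReal.ofReal (s / 2) * eLpNorm A 2 volume +
        ENNReal.ofReal (s / 2) * eLpNorm A 2 volume := by
        have h1 := eLpNorm_const_smul (s / 2 : ℂ) A 2 volume
        have h2 := eLpNorm_const_smul (s * z / 2 : ℂ) (fun x ↦ A (-x)) 2 volume
        rw [e1] at h1
        rw [e2, hneg] at h2
        exact congrArg₂ (· + ·) h1 h2
    _ = ENNReal.ofReal s * eLpNorm A 2 volume := by
        rw [← add_mul, ← ENNReal.ofReal_add (by positivity) (by positivity), add_halves]
    _ = eLpNorm f 2 volume := by
        rw [hA, eLpNorm_two_quadPhase_integral a c d e hb hf hf2, ← mul_assoc, hconst, one_mul]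

theorem eLpNorm_quadHartleyIntegral_le {b : ℝ} (a c d e : ℝ) (hb : b ≠ 0) {z : ℂ}
    (hz : ‖z‖ = 1) {p q : ENNReal} [Fact (1 ≤ p)] [Fact (1 ≤ q)] [p.HolderConjugate q]
    (hp : p ≤ 2) {f : ℝ → ℂ} (hf : Integrable f) (hfp : MemLp f p) :
    eLpNorm (quadHartleyIntegral a b c d e z f) q volume ≤
      ENNReal.ofReal (Real.sqrt (|b| / (2 * Real.pi)) ^ (2 / p.toReal - 1)) *
        eLpNorm f p volume :=
  eLpNorm_kernel_integral_le (continuous_quadHartleyKernel a b c d e z).stronglyMeasurable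
    (norm_quadHartleyKernel_le a b c d e hz) (Real.sqrt_nonneg _)
    (fun _ hu ↦ eLpNorm_two_quadHartleyIntegral_le a c d e hb hz hu
      ((SimpleFunc.memLp_iff_integrable (by norm_num) (by norm_num)).2 hu)) hp hf hfp

theorem memLp_quadHartleyIntegral {b : ℝ} (a c d e : ℝ) (hb : b ≠ 0) {z : ℂ}
    (hz : ‖z‖ = 1) {p q : ENNReal} [Fact (1 ≤ p)] [Fact (1 ≤ q)] [p.HolderConjugate q]
    (hp : p ≤ 2) {f : ℝ → ℂ} (hf : Integrable f) (hfp : MemLp f p) :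
    MemLp (quadHartleyIntegral a b c d e z f) q :=
  ⟨(stronglyMeasurable_kernel_integral
      (continuous_quadHartleyKernel a b c d e z).stronglyMeasurable hf.1).aestronglyMeasurable,
    (eLpNorm_quadHartleyIntegral_le a c d e hb hz hp hf hfp).trans_lt
      (ENNReal.mul_lt_top ENNReal.ofReal_lt_top hfp.2)⟩

/-- The subspace `L¹ ∩ Lᵖ` of `Lᵖ`. -/
def integrableLp (p : ENNReal) : Submodule ℂ (Lp ℂ p (volume : Measure ℝ)) where
  carrier := {f | Integrable f volume}
  zero_mem' := (integrable_zero ℝ ℂ volume).congr (Lp.coeFn_zero ℂ p volume).symm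
  add_mem' {f g} hf hg := (hf.add hg).congr (Lp.coeFn_add f g).symm
  smul_mem' k f hf := (hf.smul k).congr (Lp.coeFn_smul k f).symm

theorem dense_integrableLp {p : ENNReal} [Fact (1 ≤ p)] (hp0 : p ≠ 0) (hp : p ≠ ⊤) :
    Dense (integrableLp p : Set (Lp ℂ p (volume : Measure ℝ))) := by
  refine (Lp.simpleFunc.dense hp).mono fun f hf ↦ ?_
  have h := (SimpleFunc.memLp_iff_integrable hp0 hp).1 (Lp.simpleFunc.memLp ⟨f, hf⟩)
  exact h.congr (Lp.simpleFunc.toSimpleFunc_eq_toFun ⟨f, hf⟩)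

theorem quadHartleyIntegral_congr (a b c d e : ℝ) (z : ℂ) {f g : ℝ → ℂ} (h : f =ᵐ[volume] g) :
    quadHartleyIntegral a b c d e z f = quadHartleyIntegral a b c d e z g := by
  ext x
  refine integral_congr_ae ?_
  filter_upwards [h] with y hy
  rw [hy]

theorem quadHartleyIntegral_add (a b c d e : ℝ) {z : ℂ} (hz : ‖z‖ = 1) {f g : ℝ → ℂ}
    (hf : Integrable f) (hg : Integrable g) :
    quadHartleyIntegral a b c d e z (f + g) =
      quadHartleyIntegral a b c d e z f + quadHartleyIntegral a b c d e z g := by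
  have hi : ∀ {u : ℝ → ℂ}, Integrable u → ∀ x,
      Integrable fun y ↦ quadHartleyKernel a b c d e z x y * u y := fun hu x ↦
    hu.bdd_mul ((continuous_quadHartleyKernel a b c d e z).comp
      (Continuous.prodMk_right x)).aestronglyMeasurable
      (Filter.Eventually.of_forall (norm_quadHartleyKernel_le a b c d e hz x))
  ext x
  simp only [quadHartleyIntegral, Pi.add_apply, mul_add]
  exact integral_add (hi hf x) (hi hg x)

theorem quadHartleyIntegral_smul (a b c d e : ℝ) (z k : ℂ) (f : ℝ → ℂ) :
    quadHartleyIntegral a b c d e z (k • f) = k • quadHartleyIntegral a b c d e z f := by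
  ext x
  simp only [quadHartleyIntegral, Pi.smul_apply, smul_eq_mul, ← integral_const_mul]
  congr 1 with y
  ring

/-- The quadratic Hartley integral as a linear map from `L¹ ∩ Lᵖ` to `L^q`. -/
noncomputable def quadHartleyLinearMap {b : ℝ} (a c d e : ℝ) (hb : b ≠ 0) {z : ℂ}
    (hz : ‖z‖ = 1) {p q : ENNReal} [Fact (1 ≤ p)] [Fact (1 ≤ q)] [p.HolderConjugate q]
    (hp : p ≤ 2) : integrableLp p →ₗ[ℂ] Lp ℂ q (volume : Measure ℝ) where
  toFun f := (memLp_quadHartleyIntegral a c d e hb hz hp f.2 (Lp.memLp f.1)).toLp _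
  map_add' f g := by
    rw [← MemLp.toLp_add]
    refine MemLp.toLp_congr _ _ (Filter.EventuallyEq.of_eq ?_)
    rw [← quadHartleyIntegral_add a b c d e hz f.2 g.2]
    exact quadHartleyIntegral_congr _ _ _ _ _ _ (Lp.coeFn_add _ _)
  map_smul' k f := by
    rw [RingHom.id_apply, ← MemLp.toLp_const_smul]
    refine MemLp.toLp_congr _ _ (Filter.EventuallyEq.of_eq ?_)
    rw [← quadHartleyIntegral_smul]
    exact quadHartleyIntegral_congr _ _ _ _ _ _ (Lp.coeFn_smul _ _)

end Auxiliary

theorem theorem2p4 (a b c d e : ℝ) (hb : b ≠ 0) (z : ℂ) (hz : z ^ 2 = -1)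
    (p q : ENNReal) [Fact (1 ≤ p)] [Fact (1 ≤ q)] (hp : p ≤ 2) (hpq : p.HolderConjugate q) :
    (∃! T : Lp ℂ p (volume : Measure ℝ) →L[ℂ] Lp ℂ q (volume : Measure ℝ),
      IsQuadHartleyOperator a b c d e z p q T) ∧
    ∀ T : Lp ℂ p (volume : Measure ℝ) →L[ℂ] Lp ℂ q (volume : Measure ℝ),
      IsQuadHartleyOperator a b c d e z p q T →
      ∀ f : Lp ℂ p (volume : Measure ℝ),
        ‖T f‖ ≤ (Real.sqrt (|b| / (2 * Real.pi))) ^ (2 / p.toReal - 1) * ‖f‖ := by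
  have hz1 : ‖z‖ = 1 := by
    have h : ‖z‖ ^ 2 = 1 := by rw [← norm_pow, hz, norm_neg, norm_one]
    exact (pow_eq_one_iff_of_nonneg (norm_nonneg z) two_ne_zero).1 h
  have hpt : p ≠ ⊤ := (hp.trans_lt (by norm_num)).ne
  have hp0 : p ≠ 0 := (zero_lt_one.trans_le (Fact.out : 1 ≤ p)).ne'
  have hdense := dense_integrableLp hp0 hpt
  set C : ℝ := Real.sqrt (|b| / (2 * Real.pi)) ^ (2 / p.toReal - 1) with hC
  have hC0 : 0 ≤ C := Real.rpow_nonneg (Real.sqrt_nonneg _) _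
  set T₀ := quadHartleyLinearMap a c d e hb hz1 (q := q) hp with hT₀
  have hT₀n : ∀ f, ‖T₀ f‖ ≤ C * ‖(f : Lp ℂ p (volume : Measure ℝ))‖ := by
    intro f
    rw [hT₀, quadHartleyLinearMap, LinearMap.coe_mk, AddHom.coe_mk, Lp.norm_toLp, Lp.norm_def,
      ← ENNReal.toReal_ofReal hC0, ← ENNReal.toReal_mul]
    exact ENNReal.toReal_mono (ENNReal.mul_ne_top ENNReal.ofReal_ne_top (Lp.eLpNorm_ne_top _))
      (eLpNorm_quadHartleyIntegral_le a c d e hb hz1 hp f.2 (Lp.memLp f.1))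
  have hT₀c : ∀ f, (T₀ f : ℝ → ℂ) =ᵐ[volume] quadHartleyIntegral a b c d e z f.1 := fun f ↦
    MemLp.coeFn_toLp (memLp_quadHartleyIntegral a c d e hb hz1 hp f.2 (Lp.memLp f.1))
  have hdr : DenseRange (integrableLp p).subtype := by
    simpa [DenseRange] using hdense
  have heq : ∀ T : Lp ℂ p (volume : Measure ℝ) →L[ℂ] Lp ℂ q (volume : Measure ℝ),
      IsQuadHartleyOperator a b c d e z p q T → ∀ f : integrableLp p, T f = T₀ f :=
    fun T hT f ↦ Lp.ext ((hT f f.2).trans (hT₀c f).symm)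
  refine ⟨⟨T₀.extendOfNorm (integrableLp p).subtype, fun f hf ↦ ?_, fun T hT ↦ ?_⟩, fun T hT f ↦ ?_⟩
  · have h := LinearMap.extendOfNorm_eq hdr ⟨C, hT₀n⟩ ⟨f, hf⟩
    rw [Submodule.subtype_apply] at h
    rw [h]
    exact hT₀c ⟨f, hf⟩
  · exact (LinearMap.extendOfNorm_unique hdr C hT₀n T (LinearMap.ext (heq T hT))).symm
  · refine hdense.induction (P := fun f ↦ ‖T f‖ ≤ C * ‖f‖) (fun g hg ↦ ?_)
      (isClosed_le (by fun_prop) (by fun_prop)) f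
    rw [heq T hT ⟨g, hg⟩]
    exact hT₀n ⟨g, hg⟩
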